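/- **Theorem (no strict order property for Banach spaces).** Let $\mathbb F$ be $\mathbb R$ or $\mathbb C$; embeddings of normed spaces over $\mathbb F$ are linear isometries. Let $\mathcal B$ be a monster Banach space over $\mathbb F$, that is, a Banach space such that for some cardinal $\kappa>2^{\aleph_0}$: (universality) every Banach space over $\mathbb F$ with fewer than $\kappa$ elements embeds in $\mathcal B$; and (homogeneity) for every linear subspace $E\subseteq\mathcal B$ with fewer than $\kappa$ elements, every embedding $f:E\to\mathcal B$ and every $b\in\mathcal B$, $f$ extends to an embedding of $E+\mathbb F b$ in $\mathcal B$. A *positive bounded formula* is built from atomic formulas $\|t\|\le r$ and $\|t\|\ge r$ ($t$ a linear combination of variables with coefficients in $\mathbb F$, $r\in\mathbb R$) by $\wedge$, $\vee$ and the bounded quantifiers $\exists x\,(\|x\|\le r\wedge\cdot)$ and $\forall x\,(\|x\|\le r\to\cdot)$; a *positive bounded type* is a set of such formulas in finitely many fixed free variables. The type of a finite tuple in $\mathcal B$ is the set of all positive bounded formulas that it satisfies in $\mathcal B$. A family $(\bar a_i)_{i\in I}$ of $n$-tuples indexed by a linear order is *indiscernible* if, for all $k$ and all $i_1<\dots<i_k$,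 $j_1<\dots<j_k$ in $I$, the tuples $\bar a_{i_1}\dots\bar a_{i_k}$ and $\bar a_{j_1}\dots\bar a_{j_k}$ have the same type in $\mathcal B$. A formula or type $q(\bar x,\bar y)$ with $\bar x,\bar y$ both of length $n$ *exemplifies the strict order property* in $\mathcal B$ if the relation $\{(\bar a,\bar b):\mathcal B\models q(\bar a,\bar b)\}$ on $\mathcal B^n$ is a partial order (in the strict or in the reflexive sense; only transitivity and antisymmetry are required) and has an infinite indiscernible chain: there are an infinite linear order $I$ and an indiscernible family $(\bar a_i)_{i\in I}$ of pairwise distinct $n$-tuples in $\mathcal B$ such that $\mathcal B\models q(\bar a_i,\bar a_j)$ whenever $i<j$. Then no positive bounded type $q(\bar x,\bar y)$ exemplifies the strict order property in $\mathcal B$. In particular, no positive bounded formula $\varphi(\bar x,\bar y)$ does. -/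

import Mathlib

open Cardinal

universe u

/-- Positive bounded formulas (Henson's logic) of the language of normed spaces over `𝕜`, with free
variables `x₀, …, x_{n-1}`. A term of this language is a linear combination of the variables and is
given by its vector of coefficients `t : Fin n → 𝕜`. The formulas are built from the atomic formulas
`‖∑ i, t i • x i‖ ≤ r` and `‖∑ i, t i • x i‖ ≥ r` by conjunction, disjunction and the bounded
quantifiers `∃ x, ‖x‖ ≤ r ∧ φ` and `∀ x, ‖x‖ ≤ r → φ`; the quantified variable is the last one. -/
inductive PBFormula (𝕜 : Type) : ℕ → Type
  | normLE {n : ℕ} (t : Fin n → 𝕜) (r : ℝ) : PBFormula 𝕜 n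
  | normGE {n : ℕ} (t : Fin n → 𝕜) (r : ℝ) : PBFormula 𝕜 n
  | conj {n : ℕ} (φ ψ : PBFormula 𝕜 n) : PBFormula 𝕜 n
  | disj {n : ℕ} (φ ψ : PBFormula 𝕜 n) : PBFormula 𝕜 n
  | bex {n : ℕ} (r : ℝ) (φ : PBFormula 𝕜 (n + 1)) : PBFormula 𝕜 n
  | ball {n : ℕ} (r : ℝ) (φ : PBFormula 𝕜 (n + 1)) : PBFormula 𝕜 n

/-- Satisfaction `B ⊨ φ(v)` of a positive bounded formula in the normed space `B`. -/
def PBFormula.Realize {𝕜 : Type} [RCLike 𝕜] {B : Type u} [NormedAddCommGroup B]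
    [NormedSpace 𝕜 B] : {n : ℕ} → PBFormula 𝕜 n → (Fin n → B) → Prop
  | _, .normLE t r, v => ‖∑ i, t i • v i‖ ≤ r
  | _, .normGE t r, v => r ≤ ‖∑ i, t i • v i‖
  | _, .conj φ ψ, v => φ.Realize v ∧ ψ.Realize v
  | _, .disj φ ψ, v => φ.Realize v ∨ ψ.Realize v
  | _, .bex r φ, v => ∃ x : B, ‖x‖ ≤ r ∧ φ.Realize (Fin.snoc (α := fun _ => B) v x)
  | _, .ball r φ, v => ∀ x : B, ‖x‖ ≤ r → φ.Realize (Fin.snoc (α := fun _ => B) v x)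

/-- The relation `φ(x̄, ȳ)` on `n`-tuples of `B` defined by a positive bounded formula `φ`. -/
def PBFormula.rel {𝕜 : Type} [RCLike 𝕜] {n : ℕ} (φ : PBFormula 𝕜 (n + n)) (B : Type u)
    [NormedAddCommGroup B] [NormedSpace 𝕜 B] (x y : Fin n → B) : Prop :=
  φ.Realize (Fin.append x y)

/-- A positive bounded type in the variables `x₀, …, x_{n-1}`: a set of positive bounded
formulas. -/
abbrev PBType (𝕜 : Type) (n : ℕ) : Type := Set (PBFormula 𝕜 n)

/-- The relation `q(x̄, ȳ)` on `n`-tuples of `B` defined by a positive bounded type `q`. -/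
def PBType.rel {𝕜 : Type} [RCLike 𝕜] {n : ℕ} (q : PBType 𝕜 (n + n)) (B : Type u)
    [NormedAddCommGroup B] [NormedSpace 𝕜 B] (x y : Fin n → B) : Prop :=
  ∀ φ ∈ q, φ.Realize (Fin.append x y)

/-- `tp(v)`: the set of all positive bounded formulas satisfied by the tuple `v` in `B`. -/
def tp (𝕜 : Type) [RCLike 𝕜] {B : Type u} [NormedAddCommGroup B] [NormedSpace 𝕜 B]
    {n : ℕ} (v : Fin n → B) : PBType 𝕜 n :=
  {φ | φ.Realize v}

/-- The concatenation of `k` many `n`-tuples. -/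
def concatTuples {B : Type u} {k n : ℕ} (c : Fin k → Fin n → B) : Fin (k * n) → B :=
  fun p => c (finProdFinEquiv.symm p).1 (finProdFinEquiv.symm p).2

/-- A family of `n`-tuples indexed by a linear order is indiscernible: any two increasing finite
subsequences of the same length have the same type in `B`. -/
def IsIndiscernible (𝕜 : Type) [RCLike 𝕜] {B : Type u} [NormedAddCommGroup B] [NormedSpace 𝕜 B]
    {n : ℕ} {I : Type u} [LinearOrder I] (a : I → Fin n → B) : Prop :=
  ∀ (k : ℕ) (f g : Fin k → I), StrictMono f → StrictMono g →
    tp 𝕜 (concatTuples (fun i => a (f i))) = tp 𝕜 (concatTuples (fun i => a (g i)))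

/-- A relation on the `n`-tuples of `B` exemplifies the strict order property: it is a partial order
with an infinite indiscernible chain. Transitivity and antisymmetry are what strict (irreflexive)
and reflexive partial orders have in common, so both conventions are covered. The elements of the
chain are pairwise distinct, as in any chain indexed by its order type. -/
def ExemplifiesSOP (𝕜 : Type) [RCLike 𝕜] {B : Type u} [NormedAddCommGroup B] [NormedSpace 𝕜 B]
    {n : ℕ} (R : (Fin n → B) → (Fin n → B) → Prop) : Prop :=
  (∀ x y z, R x y → R y z → R x z) ∧
  (∀ x y, R x y → R y x → x = y) ∧
  ∃ (I : Type u) (_ : LinearOrder I) (_ : Infinite I) (a : I → Fin n → B),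
    IsIndiscernible 𝕜 a ∧ ∀ i j, i < j → R (a i) (a j) ∧ a i ≠ a j

/-- `B` is a monster Banach space for the cardinal `κ`: every Banach space with fewer than `κ`
elements embeds in `B` (embeddings are linear isometries), and `B` is `κ`-homogeneous. The
homogeneity is the one-point extension property; it holds in particular when `B` is strongly
`κ`-homogeneous, that is, when isometries between small subspaces extend to automorphisms. -/
structure IsMonster (𝕜 : Type) [RCLike 𝕜] (κ : Cardinal.{u}) (B : Type u) [NormedAddCommGroup B]
    [NormedSpace 𝕜 B] [CompleteSpace B] : Prop where
  universal : ∀ (X : Type u) [NormedAddCommGroup X] [NormedSpace 𝕜 X] [CompleteSpace X],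
    #X < κ → Nonempty (X →ₗᵢ[𝕜] B)
  homogeneous : ∀ E : Submodule 𝕜 B, #E < κ → ∀ (f : E →ₗᵢ[𝕜] B) (b : B),
    ∃ g : ↥(E ⊔ Submodule.span 𝕜 {b}) →ₗᵢ[𝕜] B,
      ∀ (x : B) (hx : x ∈ E), g ⟨x, Submodule.mem_sup_left hx⟩ = f ⟨x, hx⟩

/-!
Fix a positive bounded type `q` and write `R` for the relation that it defines on the `n`-tuples of
the monster `B`. Two facts about `B` are used.

* A seminorm on a finite-dimensional space is induced by a linear map to `B`, and a one-point
  extension of the seminorm of a finite tuple is realized over that tuple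
  (`IsMonster.exists_linearMap_norm_eq`, `IsMonster.exists_extension`).
* Hence `R x y` depends only on the seminorm `(s, t) ↦ ‖s · x + t · y‖`, where
  `s · x = ∑ i, s i • x i`, and the set of seminorms of related pairs is closed under pointwise
  limits. This is an induction on formulas (`IsMonster.realize_of_tendsto`). For a bounded
  existential quantifier, the witnesses have a limit seminorm along an ultrafilter, which is
  realized. For a bounded universal quantifier, a point over the limit tuple is copied over each of
  the approximating tuples, at a small distance, by an amalgam
  (`Seminorm.exists_extension_near`).

Let `p` be the common seminorm of the increasing pairs of an indiscernible `R`-chain. If `R` is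
transitive, free amalgamation over the middle tuple shows that `p` composed with itself,
`(s, t) ↦ ⨅ w, p (s, -w) + p (w, t)`, is again the seminorm of a related pair, and so are all the
iterated compositions (`IsMonster.exists_rel_pow`). They increase with the number of factors and are
bounded, so they converge to a seminorm `N ≥ p`, which is the seminorm of a related pair `(x, y)`
since `R` is closed.

The point of the proof is that `N` is symmetric. The value of an iterated composition at `(s, t)` is
the infimum of the lengths of paths `s = u₀, u₁, …, u_m = -t`, where the step from `u` to `w` has
length `p (u, -w)`. Put `δ u = p (u, -u)`; in a chain `a`, this is the norm of
`u · (a i) - u · (a j)` for `i ≠ j`. A step from `u` costs at least `δ u / 2`, so a path of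
bounded length with many steps visits some `u` with `δ u` small
(`IsChainSeminorm.exists_small_diag`). At such a point the order of the chain is almost
invisible: up to multiples of `δ u`, it costs nothing to reverse the two parts of the path, or to
wait at `u` (`IsChainSeminorm.pow_swap_le`).

Symmetry gives `R x y` and `R y x`, so `x = y` by antisymmetry. Then `p (s, -s) ≤ N (s, -s) = 0` for
all `s`, which says that the two members of a pair in the chain are equal, a contradiction.
-/

open Filter Topology

/-! ### Partial infima and limits of seminorms -/

theorem bddBelow_range_seminorm {𝕜 W X : Type*} [RCLike 𝕜] [AddCommGroup W] [Module 𝕜 W]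
    [AddCommGroup X] [Module 𝕜 X] (N : Seminorm 𝕜 (W × X)) (x : X) :
    BddBelow (Set.range fun w => N (w, x)) :=
  ⟨0, by rintro _ ⟨w, rfl⟩; exact apply_nonneg N _⟩

/-- The seminorm obtained from a seminorm on `W × X` by minimizing over the first coordinate. -/
noncomputable def Seminorm.partialInf {𝕜 W X : Type*} [RCLike 𝕜] [AddCommGroup W] [Module 𝕜 W]
    [AddCommGroup X] [Module 𝕜 X] (N : Seminorm 𝕜 (W × X)) : Seminorm 𝕜 X :=
  Seminorm.ofSMulLE (fun x => ⨅ w, N (w, x))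
    (le_antisymm ((ciInf_le (bddBelow_range_seminorm N 0) 0).trans_eq (map_zero N))
      (le_ciInf fun _ => apply_nonneg N _))
    (fun x y => le_ciInf_add_ciInf fun w w' =>
      (ciInf_le (bddBelow_range_seminorm N (x + y)) (w + w')).trans
        (map_add_le_add N (w, x) (w', y)))
    (fun c x => by
      rw [Real.mul_iInf_of_nonneg (norm_nonneg c)]
      refine le_ciInf fun w => (ciInf_le (bddBelow_range_seminorm N (c • x)) (c • w)).trans_eq ?_
      exact map_smul_eq_mul N c (w, x))

section PartialInf

variable {𝕜 W X : Type*} [RCLike 𝕜] [AddCommGroup W] [Module 𝕜 W]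
    [AddCommGroup X] [Module 𝕜 X] (N : Seminorm 𝕜 (W × X))

theorem Seminorm.partialInf_le (w : W) (x : X) : N.partialInf x ≤ N (w, x) :=
  ciInf_le (bddBelow_range_seminorm N x) w

theorem Seminorm.le_partialInf {x : X} {c : ℝ} (h : ∀ w, c ≤ N (w, x)) : c ≤ N.partialInf x :=
  le_ciInf h

theorem Seminorm.exists_lt_of_partialInf_lt {x : X} {c : ℝ} (h : N.partialInf x < c) :
    ∃ w, N (w, x) < c :=
  exists_lt_of_ciInf_lt h

end PartialInf

/-- A pointwise limit of seminorms is a seminorm. -/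
theorem Seminorm.exists_tendsto {𝕜 W ι : Type*} [RCLike 𝕜] [AddCommGroup W] [Module 𝕜 W]
    {l : Filter ι} [l.NeBot] (N : ι → Seminorm 𝕜 W)
    (h : ∀ w, ∃ c, Tendsto (fun i => N i w) l (𝓝 c)) :
    ∃ N' : Seminorm 𝕜 W, ∀ w, Tendsto (fun i => N i w) l (𝓝 (N' w)) := by
  choose f hf using h
  refine ⟨Seminorm.of f (fun x y => ?_) fun c x => ?_, hf⟩
  · exact le_of_tendsto_of_tendsto' (hf _) ((hf x).add (hf y)) fun i => map_add_le_add (N i) x y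
  · refine tendsto_nhds_unique (hf _) (((hf x).const_mul ‖c‖).congr fun i => ?_)
    exact (map_smul_eq_mul (N i) c x).symm

/-! ### Composition of seminorms by free amalgamation -/

section Amalgam

variable {𝕜 V : Type*} [RCLike 𝕜] [AddCommGroup V] [Module 𝕜 V]

/-- The free amalgam of two seminorms on `V × V` over the middle copy of `V`: the largest seminorm
on `V × V × V` that is at most `q₁` on the first two coordinates and at most `q₂` on the last two.
Explicitly `(s, u, t) ↦ ⨅ w, q₁ (s, u - w) + q₂ (w, t)`. -/
noncomputable def freeAmalgam (q₁ q₂ : Seminorm 𝕜 (V × V)) : Seminorm 𝕜 (V × V × V) :=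
  Seminorm.partialInf
    (q₁.comp (((LinearMap.fst 𝕜 V (V × V)).comp (LinearMap.snd 𝕜 V (V × V × V))).prod
        ((LinearMap.fst 𝕜 V V).comp ((LinearMap.snd 𝕜 V (V × V)).comp
          (LinearMap.snd 𝕜 V (V × V × V))) - LinearMap.fst 𝕜 V (V × V × V))) +
      q₂.comp ((LinearMap.fst 𝕜 V (V × V × V)).prod
        ((LinearMap.snd 𝕜 V V).comp ((LinearMap.snd 𝕜 V (V × V)).comp
          (LinearMap.snd 𝕜 V (V × V × V))))))

theorem freeAmalgam_le (q₁ q₂ : Seminorm 𝕜 (V × V)) (s u t w : V) :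
    freeAmalgam q₁ q₂ (s, u, t) ≤ q₁ (s, u - w) + q₂ (w, t) :=
  Seminorm.partialInf_le _ w (s, u, t)

theorem le_freeAmalgam {q₁ q₂ : Seminorm 𝕜 (V × V)} {s u t : V} {c : ℝ}
    (h : ∀ w, c ≤ q₁ (s, u - w) + q₂ (w, t)) : c ≤ freeAmalgam q₁ q₂ (s, u, t) :=
  Seminorm.le_partialInf _ h

theorem exists_lt_of_freeAmalgam_lt {q₁ q₂ : Seminorm 𝕜 (V × V)} {s u t : V} {c : ℝ}
    (h : freeAmalgam q₁ q₂ (s, u, t) < c) : ∃ w, q₁ (s, u - w) + q₂ (w, t) < c :=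
  Seminorm.exists_lt_of_partialInf_lt _ h

theorem freeAmalgam_left {q₁ q₂ : Seminorm 𝕜 (V × V)} (h : ∀ u, q₁ (0, u) = q₂ (u, 0)) (s u : V) :
    freeAmalgam q₁ q₂ (s, u, 0) = q₁ (s, u) := by
  refine le_antisymm ((freeAmalgam_le q₁ q₂ s u 0 0).trans_eq ?_) (le_freeAmalgam fun w => ?_)
  · rw [← h, ← Prod.zero_eq_mk, map_zero, sub_zero, add_zero]
  · rw [← h]
    simpa using map_add_le_add q₁ (s, u - w) (0, w)

theorem freeAmalgam_right {q₁ q₂ : Seminorm 𝕜 (V × V)} (h : ∀ u, q₁ (0, u) = q₂ (u, 0)) (u t : V) :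
    freeAmalgam q₁ q₂ (0, u, t) = q₂ (u, t) := by
  refine le_antisymm ((freeAmalgam_le q₁ q₂ 0 u t u).trans_eq ?_) (le_freeAmalgam fun w => ?_)
  · rw [sub_self, ← Prod.zero_eq_mk, map_zero, zero_add]
  · rw [h]
    simpa using map_add_le_add q₂ (u - w, 0) (w, t)

/-- The composition `(s, t) ↦ ⨅ w, q₁ (s, -w) + q₂ (w, t)` of two seminorms on `V × V`: the
seminorm that the free amalgam induces on the two outer coordinates. -/
noncomputable def seminormComp (q₁ q₂ : Seminorm 𝕜 (V × V)) : Seminorm 𝕜 (V × V) :=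
  (freeAmalgam q₁ q₂).comp ((LinearMap.fst 𝕜 V V).prod ((0 : V × V →ₗ[𝕜] V).prod
    (LinearMap.snd 𝕜 V V)))

theorem seminormComp_apply (q₁ q₂ : Seminorm 𝕜 (V × V)) (s t : V) :
    seminormComp q₁ q₂ (s, t) = freeAmalgam q₁ q₂ (s, 0, t) := rfl

theorem seminormComp_le (q₁ q₂ : Seminorm 𝕜 (V × V)) (s t w : V) :
    seminormComp q₁ q₂ (s, t) ≤ q₁ (s, -w) + q₂ (w, t) := by
  simpa [seminormComp_apply] using freeAmalgam_le q₁ q₂ s 0 t w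

theorem le_seminormComp {q₁ q₂ : Seminorm 𝕜 (V × V)} {s t : V} {c : ℝ}
    (h : ∀ w, c ≤ q₁ (s, -w) + q₂ (w, t)) : c ≤ seminormComp q₁ q₂ (s, t) :=
  le_freeAmalgam fun w => by simpa using h w

theorem exists_lt_of_seminormComp_lt {q₁ q₂ : Seminorm 𝕜 (V × V)} {s t : V} {c : ℝ}
    (h : seminormComp q₁ q₂ (s, t) < c) : ∃ w, q₁ (s, -w) + q₂ (w, t) < c := by
  simpa using exists_lt_of_freeAmalgam_lt (u := (0 : V)) h

/-! ### Iterated composition and its symmetric limit -/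

/-- The inequalities satisfied by the seminorm `p (s, t) = ‖s · a + t · b‖` when `(a, b)` are any
two successive terms of a chain of three tuples in which all increasing pairs are isometric. -/
structure IsChainSeminorm (p : Seminorm 𝕜 (V × V)) : Prop where
  le_trans : ∀ s t w, p (s, t) ≤ p (s, -w) + p (w, t)
  diag_le : ∀ w t, p (w, -w) ≤ 2 * p (w, t)
  swap_left : ∀ u s, p (u, s) ≤ p (s, u) + p (u, -u)
  swap_right : ∀ t u, p (t, u) ≤ p (u, t) + p (u, -u)
  left_eq_right : ∀ s, p (s, 0) = p (0, s)

/-- The `m`-fold composition of `p` with itself (`m + 1` factors): the seminorm on the two end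
points of a chain of `m + 2` points whose consecutive pairs are isometric to `p` and which is
otherwise as free as possible. -/
noncomputable def seminormPow (p : Seminorm 𝕜 (V × V)) : ℕ → Seminorm 𝕜 (V × V)
  | 0 => p
  | m + 1 => seminormComp (seminormPow p m) p

namespace IsChainSeminorm

variable {p : Seminorm 𝕜 (V × V)}

theorem le_pow (hp : IsChainSeminorm p) (m : ℕ) (s t : V) : p (s, t) ≤ seminormPow p m (s, t) := by
  induction m generalizing s t with
  | zero => exact le_rfl
  | succ m ih =>
    exact le_seminormComp fun w => (hp.le_trans s t w).trans (add_le_add_left (ih s (-w)) _)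

theorem pow_neg_le (m : ℕ) (s u : V) :
    seminormPow p m (s, -u) ≤ p (s, -u) + m * p (u, -u) := by
  induction m with
  | zero => simp [seminormPow]
  | succ m ih =>
    have := seminormComp_le (seminormPow p m) p s (-u) u
    rw [seminormPow]
    push_cast
    linarith

/-- The path from `s` to `-t` that waits at `u` for all intermediate steps. -/
theorem pow_succ_le (m : ℕ) (s u t : V) :
    seminormPow p (m + 1) (s, t) ≤ p (s, -u) + m * p (u, -u) + p (u, t) :=
  (seminormComp_le (seminormPow p m) p s t u).trans (add_le_add_left (pow_neg_le m s u) _)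

/-- A bound for the iterated compositions that is uniform in `m`: the path through `0`. -/
theorem pow_le (m : ℕ) (s t : V) : seminormPow p m (s, t) ≤ p (s, 0) + p (0, t) := by
  cases m with
  | zero => simpa [seminormPow] using map_add_le_add p (s, 0) (0, t)
  | succ m => simpa [← Prod.zero_eq_mk] using pow_succ_le (p := p) m s 0 t

/-- The compositions do not change the seminorm of the single end points, so they can be amalgamated
with `p` again. -/
theorem pow_zero_left (hp : IsChainSeminorm p) (m : ℕ) (u : V) :
    seminormPow p m (0, u) = p (u, 0) := by
  rw [hp.left_eq_right]
  refine le_antisymm ((pow_le m 0 u).trans_eq ?_) (hp.le_pow m 0 u)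
  rw [← Prod.zero_eq_mk, map_zero, zero_add]

theorem pow_mono (hp : IsChainSeminorm p) (s t : V) :
    Monotone fun m => seminormPow p m (s, t) := by
  have key : ∀ m s t, seminormPow p m (s, t) ≤ seminormPow p (m + 1) (s, t) := by
    intro m
    induction m with
    | zero => exact fun s t => hp.le_pow 1 s t
    | succ m ih =>
      exact fun s t => le_seminormComp fun w =>
        (seminormComp_le (seminormPow p m) p s t w).trans (add_le_add_left (ih s (-w)) _)
  exact monotone_nat_of_le_succ fun m => key m s t

/-- An almost optimal path for the `(m + 1)`-fold composition passes through a point `u` with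
`p (u, -u)` of order `1 / m`. -/
theorem exists_small_diag (hp : IsChainSeminorm p) (m : ℕ) (s t : V) {c : ℝ}
    (hc : seminormPow p (m + 1) (s, t) < c) :
    ∃ u, p (s, -u) + p (u, t) ≤ c ∧ (m + 1) * p (u, -u) ≤ 2 * c := by
  induction m generalizing t c with
  | zero =>
    obtain ⟨w, hw⟩ := exists_lt_of_seminormComp_lt hc
    have h0 := apply_nonneg p (s, -w)
    have h1 := hp.diag_le w t
    simp only [seminormPow] at hw
    exact ⟨w, hw.le, by norm_num; linarith⟩
  | succ m ih =>
    obtain ⟨w, hw⟩ := exists_lt_of_seminormComp_lt hc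
    obtain ⟨u, hu, hu'⟩ := ih (-w) (c := c - p (w, t)) (by linarith)
    have h1 := hp.diag_le w t
    have h2 := hp.le_pow (m + 1) s (-w)
    push_cast
    -- keep whichever of the two points has the smaller diagonal value
    rcases le_total (p (u, -u)) (p (w, -w)) with h | h
    · refine ⟨u, ?_, by linarith⟩
      have := hp.le_trans u t w
      linarith
    · refine ⟨w, by linarith, ?_⟩
      have : ((m : ℝ) + 1) * p (w, -w) ≤ (m + 1) * p (u, -u) := by gcongr
      linarith

/-- The iterated compositions are asymptotically symmetric: a nearly shortest path from `s` to `-t`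
with about `m` steps passes through a point `u` with small `p (u, -u)`, and the path from `t` to `-s`
that waits at `-u` for about `k` steps costs little more. -/
theorem pow_swap_le (hp : IsChainSeminorm p) (k m : ℕ) (s t : V) :
    seminormPow p (k + 1) (t, s) ≤
      (1 + (k + 2) * 2 / (m + 1)) * seminormPow p (m + 1) (s, t) := by
  have hpos : (0 : ℝ) < 1 + (k + 2) * 2 / (m + 1) := by positivity
  rw [← div_le_iff₀' hpos]
  refine le_of_forall_gt_imp_ge_of_dense fun c hc => ?_
  rw [div_le_iff₀' hpos]
  obtain ⟨u, hu, hu'⟩ := hp.exists_small_diag m s t hc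
  have h1 := pow_succ_le (p := p) k t (-u) s
  have h2 := hp.swap_right t u
  have h3 := hp.swap_left (-u) s
  have h4 : p (-u, u) = p (u, -u) := by
    rw [← map_neg_eq_map p (u, -u), Prod.neg_mk, neg_neg]
  rw [neg_neg, h4] at h1 h3
  have h5 : (k + 2) * p (u, -u) ≤ (k + 2) * (2 * c / (m + 1)) := by
    gcongr
    rw [le_div_iff₀ (by positivity)]
    linarith
  calc seminormPow p (k + 1) (t, s) ≤ c + (k + 2) * p (u, -u) := by linarith
    _ ≤ c + (k + 2) * (2 * c / (m + 1)) := by linarith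
    _ = (1 + (k + 2) * 2 / (m + 1)) * c := by ring

end IsChainSeminorm
end Amalgam

/-- The iterated compositions of a chain seminorm converge to a symmetric seminorm. -/
theorem IsChainSeminorm.exists_symm_limit {𝕜 V : Type*} [RCLike 𝕜] [AddCommGroup V] [Module 𝕜 V]
    {p : Seminorm 𝕜 (V × V)} (hp : IsChainSeminorm p) :
    ∃ N : Seminorm 𝕜 (V × V), (∀ w, Tendsto (fun m => seminormPow p m w) atTop (𝓝 (N w))) ∧
      (∀ w, p w ≤ N w) ∧ ∀ s t, N (s, t) = N (t, s) := by
  obtain ⟨N, hN⟩ := Seminorm.exists_tendsto (l := atTop) (seminormPow p) fun ⟨s, t⟩ =>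
    ⟨_, tendsto_atTop_ciSup (hp.pow_mono s t)
      ⟨p (s, 0) + p (0, t), by rintro _ ⟨m, rfl⟩; exact IsChainSeminorm.pow_le m s t⟩⟩
  have hle : ∀ s t, N (t, s) ≤ N (s, t) := by
    intro s t
    refine le_of_tendsto' ((tendsto_add_atTop_iff_nat 1).2 (hN (t, s))) fun k => ?_
    have h1 : Tendsto (fun m : ℕ => ((k : ℝ) + 2) * 2 / (m + 1)) atTop (𝓝 0) := by
      simpa [div_eq_mul_inv] using
        (tendsto_one_div_add_atTop_nhds_zero_nat (𝕜 := ℝ)).const_mul (((k : ℝ) + 2) * 2)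
    have h2 := (h1.const_add 1).mul ((tendsto_add_atTop_iff_nat 1).2 (hN (s, t)))
    rw [add_zero, one_mul] at h2
    exact ge_of_tendsto' h2 fun m => hp.pow_swap_le k m s t
  exact ⟨N, hN, fun ⟨s, t⟩ => ge_of_tendsto' (hN (s, t)) fun m => hp.le_pow m s t,
    fun s t => le_antisymm (hle t s) (hle s t)⟩

/-! ### Realizing seminorms in the monster -/

theorem RCLike.mk_le_continuum (𝕜 : Type) [RCLike 𝕜] : #𝕜 ≤ 𝔠 := by
  have h : Function.Injective fun z : 𝕜 => (RCLike.re z, RCLike.im z) := fun z w hzw =>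
    RCLike.ext (congrArg Prod.fst hzw) (congrArg Prod.snd hzw)
  simpa [Cardinal.mk_real] using Cardinal.mk_le_of_injective h

/-- An image of a finite-dimensional space over `ℝ` or `ℂ` has at most `2 ^ ℵ₀` elements. -/
theorem mk_le_continuum_of_surjective {𝕜 : Type} [RCLike 𝕜] {W : Type} [AddCommGroup W]
    [Module 𝕜 W] [FiniteDimensional 𝕜 W] {Y : Type u} {f : W → Y} (hf : Function.Surjective f) :
    #Y ≤ 𝔠 := by
  have h1 : #W ≤ 𝔠 := by
    rw [Cardinal.mk_congr (Module.finBasis 𝕜 W).equivFun.toEquiv, ← Cardinal.power_def]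
    refine (Cardinal.power_le_power_right (RCLike.mk_le_continuum 𝕜)).trans ?_
    rw [Cardinal.mk_fin]
    exact (Cardinal.power_le_power_left Cardinal.continuum_ne_zero
      Cardinal.natCast_lt_aleph0.le).trans Cardinal.continuum_power_aleph0.le
  have h2 : #Y ≤ #(ULift.{u} W) :=
    Cardinal.mk_le_of_surjective (f := f ∘ ULift.down) (hf.comp ULift.down_surjective)
  refine h2.trans ?_
  rw [Cardinal.mk_uLift]
  simpa using Cardinal.lift_le.{u}.2 h1

section Monster

variable {𝕜 : Type} [RCLike 𝕜] {κ : Cardinal.{u}} {B : Type u} [NormedAddCommGroup B]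
    [NormedSpace 𝕜 B] [CompleteSpace B]

/-- Every seminorm on a finite-dimensional space is induced by a linear map to the monster. -/
theorem IsMonster.exists_linearMap_norm_eq (hB : IsMonster 𝕜 κ B) (hκ : 𝔠 < κ)
    {W : Type} [AddCommGroup W] [Module 𝕜 W] [FiniteDimensional 𝕜 W] (N : Seminorm 𝕜 W) :
    ∃ L : W →ₗ[𝕜] B, ∀ w, ‖L w‖ = N w := by
  let : SeminormedAddCommGroup W := N.toAddGroupSeminorm.toSeminormedAddCommGroup
  let : NormedSpace 𝕜 W := ⟨fun c w => (map_smul_eq_mul N c w).le⟩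
  let π : W →ₗ[𝕜] ULift.{u} (SeparationQuotient W) :=
    ULift.moduleEquiv.symm.toLinearMap ∘ₗ (SeparationQuotient.mkCLM 𝕜 W).toLinearMap
  have hπ : Function.Surjective π :=
    ULift.moduleEquiv.symm.surjective.comp SeparationQuotient.surjective_mk
  have : FiniteDimensional 𝕜 (ULift.{u} (SeparationQuotient W)) := Module.Finite.of_surjective π hπ
  have : CompleteSpace (ULift.{u} (SeparationQuotient W)) := FiniteDimensional.complete 𝕜 _
  obtain ⟨j⟩ := hB.universal (ULift.{u} (SeparationQuotient W))
    ((mk_le_continuum_of_surjective (𝕜 := 𝕜) hπ).trans_lt hκ)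
  exact ⟨j.toLinearMap ∘ₗ π, fun w => (j.norm_map _).trans (SeparationQuotient.norm_mk w)⟩

/-- A one-point extension of the seminorm induced by a finite tuple of the monster is realized in
the monster over that tuple. -/
theorem IsMonster.exists_extension (hB : IsMonster 𝕜 κ B) (hκ : 𝔠 < κ) {n : ℕ} (v : Fin n → B)
    (N : Seminorm 𝕜 ((Fin n → 𝕜) × 𝕜))
    (hN : ∀ t, N (t, 0) = ‖Fintype.linearCombination 𝕜 v t‖) :
    ∃ x : B, ∀ t s, ‖Fintype.linearCombination 𝕜 v t + s • x‖ = N (t, s) := by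
  obtain ⟨L, hL⟩ := hB.exists_linearMap_norm_eq hκ N
  let A : (Fin n → 𝕜) →ₗ[𝕜] B := L ∘ₗ LinearMap.inl 𝕜 (Fin n → 𝕜) 𝕜
  have hA : ∀ t, ‖A t‖ = ‖Fintype.linearCombination 𝕜 v t‖ := fun t => (hL _).trans (hN t)
  have hker : LinearMap.ker A ≤ LinearMap.ker (Fintype.linearCombination 𝕜 v) := fun t ht => by
    rw [LinearMap.mem_ker] at ht ⊢
    rw [← norm_eq_zero, ← hA, ht, norm_zero]
  let f₀ : LinearMap.range A →ₗ[𝕜] B :=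
    (LinearMap.ker A).liftQ (Fintype.linearCombination 𝕜 v) hker ∘ₗ
      A.quotKerEquivRange.symm.toLinearMap
  have hf₀ : ∀ t (h : A t ∈ LinearMap.range A), f₀ ⟨A t, h⟩ = Fintype.linearCombination 𝕜 v t := by
    intro t h
    simp only [f₀, LinearMap.comp_apply, LinearEquiv.coe_coe,
      LinearMap.quotKerEquivRange_symm_apply_image, Submodule.mkQ_apply, Submodule.liftQ_apply]
  let f : LinearMap.range A →ₗᵢ[𝕜] B := ⟨f₀, by
    rintro ⟨_, t, rfl⟩
    exact (congrArg norm (hf₀ t _)).trans (hA t).symm⟩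
  obtain ⟨g, hg⟩ := hB.homogeneous (LinearMap.range A)
    ((mk_le_continuum_of_surjective (𝕜 := 𝕜) A.surjective_rangeRestrict).trans_lt hκ) f (L (0, 1))
  have hb : L (0, 1) ∈ LinearMap.range A ⊔ Submodule.span 𝕜 {L (0, 1)} :=
    Submodule.mem_sup_right (Submodule.mem_span_singleton_self _)
  refine ⟨g ⟨L (0, 1), hb⟩, fun t s => ?_⟩
  have hAt : A t ∈ LinearMap.range A := ⟨t, rfl⟩
  rw [← hf₀ t hAt, show f₀ ⟨A t, hAt⟩ = f ⟨A t, hAt⟩ from rfl, ← hg (A t) hAt, ← map_smul,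
    ← map_add, g.norm_map, ← hL]
  simp only [Submodule.coe_norm, Submodule.coe_add, Submodule.coe_smul, A, LinearMap.comp_apply,
    LinearMap.inl_apply, ← map_smul, ← map_add]
  simp

end Monster

/-! ### Perturbation of seminorms on finite-dimensional spaces -/

section Perturbation

variable {𝕜 : Type*} [RCLike 𝕜] {n : ℕ}

theorem Seminorm.le_sum_single_mul_norm (N : Seminorm 𝕜 (Fin n → 𝕜)) (w : Fin n → 𝕜) :
    N w ≤ (∑ k, N (Pi.single k 1)) * ‖w‖ := by
  conv_lhs => rw [← Finset.univ_sum_single w]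
  refine (Finset.le_sum_of_subadditive N (map_zero N).le (map_add_le_add N) _ _).trans ?_
  rw [Finset.sum_mul]
  refine Finset.sum_le_sum fun k _ => ?_
  have h : (Pi.single k (w k) : Fin n → 𝕜) = w k • Pi.single k 1 := by
    rw [← Pi.single_smul, smul_eq_mul, mul_one]
  rw [h, map_smul_eq_mul, mul_comm]
  gcongr
  exact norm_le_pi_norm w k

/-- On a finite-dimensional space, seminorms that converge pointwise converge uniformly on bounded
sets. -/
theorem Seminorm.exists_tendsto_zero_of_tendsto {ι : Type*} {l : Filter ι}
    {N : ι → Seminorm 𝕜 (Fin n → 𝕜)} {N' : Seminorm 𝕜 (Fin n → 𝕜)}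
    (h : ∀ w, Tendsto (fun i => N i w) l (𝓝 (N' w))) :
    ∃ ε : ι → NNReal, (∀ i w, |N i w - N' w| ≤ ε i * ‖w‖) ∧ Tendsto ε l (𝓝 0) := by
  set S : Seminorm 𝕜 (Fin n → 𝕜) → ℝ := fun M => ∑ k, M (Pi.single k 1) with hS
  have hS0 : ∀ M, 0 ≤ S M := fun M => Finset.sum_nonneg fun k _ => apply_nonneg M _
  have hbdd : ∀ i, BddAbove (Set.range fun w : Metric.closedBall (0 : Fin n → 𝕜) 1 =>
      |N i w - N' w|) := by
    rintro i
    refine ⟨S (N i) + S N', ?_⟩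
    rintro _ ⟨⟨w, hw⟩, rfl⟩
    rw [mem_closedBall_zero_iff] at hw
    have h1 := (N i).le_sum_single_mul_norm w
    have h2 := N'.le_sum_single_mul_norm w
    have h3 := mul_le_of_le_one_right (hS0 (N i)) hw
    have h4 := mul_le_of_le_one_right (hS0 N') hw
    refine abs_sub_le_iff.2 ⟨?_, ?_⟩ <;>
      linarith [apply_nonneg (N i) w, apply_nonneg N' w, hS0 (N i), hS0 N']
  let e : ι → ℝ := fun i => ⨆ w : Metric.closedBall (0 : Fin n → 𝕜) 1, |N i w - N' w|
  have hnn : ∀ i, 0 ≤ e i := fun i => Real.iSup_nonneg fun w => abs_nonneg _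
  refine ⟨fun i => (e i).toNNReal, ?_, ?_⟩
  · intro i w
    rw [Real.coe_toNNReal _ (hnn i)]
    rcases eq_or_ne w 0 with rfl | hw
    · simp
    have hw' : 0 < ‖w‖ := norm_pos_iff.2 hw
    have hu : ((‖w‖⁻¹ : ℝ) : 𝕜) • w ∈ Metric.closedBall (0 : Fin n → 𝕜) 1 := by
      rw [mem_closedBall_zero_iff, norm_smul, RCLike.norm_ofReal, abs_of_pos (inv_pos.2 hw'),
        inv_mul_cancel₀ hw'.ne']
    have := le_ciSup (hbdd i) ⟨_, hu⟩
    simp only [map_smul_eq_mul, RCLike.norm_ofReal, abs_of_pos (inv_pos.2 hw'), ← mul_sub,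
      abs_mul] at this
    rwa [inv_mul_le_iff₀ hw', mul_comm] at this
  · suffices h0 : Tendsto e l (𝓝 0) by simpa using tendsto_real_toNNReal h0
    refine Metric.tendsto_nhds.2 fun ε hε => ?_
    have hSt : Tendsto (fun i => S (N i)) l (𝓝 (S N')) := tendsto_finsetSum _ fun k _ => h _
    -- all `N i` with `i` large, and `N'`, have the common Lipschitz constant `C`
    set C := S N' + 1 with hC
    have hCpos : 0 < C := by linarith [hS0 N']
    obtain ⟨T, -, hTfin, hT⟩ := (isCompact_closedBall (0 : Fin n → 𝕜) 1).finite_cover_balls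
      (show 0 < ε / (8 * C) by positivity)
    have hT' : ∀ᶠ i in l, ∀ c ∈ T, |N i c - N' c| < ε / 4 :=
      (eventually_all_finite hTfin).2 fun c _ => by
        simpa [Real.dist_eq] using Metric.tendsto_nhds.1 (h c) (ε / 4) (by positivity)
    filter_upwards [hT', hSt.eventually_lt_const (show S N' < C by linarith)] with i hi hiC
    simp only [Real.dist_eq, sub_zero, abs_of_nonneg (hnn i)]
    have : Nonempty (Metric.closedBall (0 : Fin n → 𝕜) 1) := ⟨⟨0, by simp⟩⟩
    refine (ciSup_le fun w => ?_).trans_lt (half_lt_self hε)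
    obtain ⟨c, hcT, hc⟩ : ∃ c ∈ T, (w : Fin n → 𝕜) ∈ Metric.ball c (ε / (8 * C)) := by
      simpa using hT w.2
    have hle : ∀ M : Seminorm 𝕜 (Fin n → 𝕜), S M ≤ C → |M w - M c| ≤ ε / 8 := fun M hM => by
      refine (abs_sub_map_le_sub M _ _).trans ((M.le_sum_single_mul_norm _).trans ?_)
      rw [Metric.mem_ball, dist_eq_norm] at hc
      calc S M * ‖(w : Fin n → 𝕜) - c‖ ≤ C * (ε / (8 * C)) := by gcongr
        _ = ε / 8 := by field_simp
    have h1 := abs_sub_le_iff.1 (hle (N i) hiC.le)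
    have h2 := abs_sub_le_iff.1 (hle N' (by linarith))
    have h3 := abs_lt.1 (hi c hcT)
    refine abs_sub_le_iff.2 ⟨?_, ?_⟩ <;> linarith [h1.1, h1.2, h2.1, h2.2, h3.1, h3.2]

/-- If `N₁` is `ε`-close to the restriction of `N` to the first factor, then `N₁` extends to a
seminorm that is `ε`-close to `N` and does not increase the norm of the second factor. -/
theorem Seminorm.exists_extension_near (N : Seminorm 𝕜 ((Fin n → 𝕜) × 𝕜))
    (N₁ : Seminorm 𝕜 (Fin n → 𝕜)) (ε : NNReal) (h : ∀ w, |N₁ w - N (w, 0)| ≤ ε * ‖w‖) :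
    ∃ N' : Seminorm 𝕜 ((Fin n → 𝕜) × 𝕜), (∀ t, N' (t, 0) = N₁ t) ∧
      (∀ s, N' (0, s) ≤ N (0, s)) ∧ ∀ t s, |N' (t, s) - N (t, s)| ≤ ε * ‖t‖ := by
  -- `N' (t, s) = ⨅ w, N₁ (t - w) + N (w, s) + ε * ‖w‖`: an amalgam in which the two copies of the
  -- first factor are kept at distance at most `ε`
  let M : Seminorm 𝕜 ((Fin n → 𝕜) × (Fin n → 𝕜) × 𝕜) :=
    N₁.comp (LinearMap.fst 𝕜 (Fin n → 𝕜) 𝕜 ∘ₗ LinearMap.snd 𝕜 (Fin n → 𝕜) ((Fin n → 𝕜) × 𝕜) -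
      LinearMap.fst 𝕜 (Fin n → 𝕜) ((Fin n → 𝕜) × 𝕜)) +
    N.comp ((LinearMap.fst 𝕜 (Fin n → 𝕜) ((Fin n → 𝕜) × 𝕜)).prod
      (LinearMap.snd 𝕜 (Fin n → 𝕜) 𝕜 ∘ₗ LinearMap.snd 𝕜 (Fin n → 𝕜) ((Fin n → 𝕜) × 𝕜))) +
    ε • (normSeminorm 𝕜 (Fin n → 𝕜)).comp (LinearMap.fst 𝕜 (Fin n → 𝕜) ((Fin n → 𝕜) × 𝕜))
  have hM : ∀ w t s, M (w, t, s) = N₁ (t - w) + N (w, s) + ε * ‖w‖ := fun w t s => rfl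
  have hle : ∀ t s w, M.partialInf (t, s) ≤ N₁ (t - w) + N (w, s) + ε * ‖w‖ := fun t s w =>
    (M.partialInf_le w (t, s)).trans_eq (hM w t s)
  refine ⟨M.partialInf, fun t => le_antisymm ?_ ?_, fun s => ?_, fun t s =>
    abs_sub_le_iff.2 ⟨?_, ?_⟩⟩
  · simpa [← Prod.zero_eq_mk] using hle t 0 0
  · refine M.le_partialInf fun w => ?_
    rw [hM]
    have h1 := (abs_sub_le_iff.1 (h w)).1
    have h2 : N₁ t ≤ N₁ (t - w) + N₁ w := by simpa using map_add_le_add N₁ (t - w) w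
    linarith
  · simpa using hle 0 s 0
  · have := hle t s t
    rw [sub_self, map_zero] at this
    linarith
  · rw [sub_le_comm]
    refine M.le_partialInf fun w => ?_
    rw [hM]
    have h1 := (abs_sub_le_iff.1 (h (t - w))).2
    have h2 : N (t, s) ≤ N (t - w, 0) + N (w, s) := by
      simpa using map_add_le_add N (t - w, 0) (w, s)
    have h3 : (ε : ℝ) * ‖t - w‖ ≤ ε * (‖t‖ + ‖w‖) := by
      gcongr
      exact norm_sub_le t w
    linarith

end Perturbation

/-! ### Positive bounded formulas and limits of seminorms -/

theorem Fintype.linearCombination_snoc {𝕜 B : Type*} [RCLike 𝕜] [AddCommGroup B] [Module 𝕜 B]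
    {n : ℕ} (v : Fin n → B) (x : B) (t : Fin (n + 1) → 𝕜) :
    Fintype.linearCombination 𝕜 (Fin.snoc (α := fun _ => B) v x) t =
      Fintype.linearCombination 𝕜 v (Fin.init t) + t (Fin.last n) • x := by
  simp [Fintype.linearCombination_apply, Fin.sum_univ_castSucc, Fin.init]

section Closed

variable {𝕜 : Type} [RCLike 𝕜] {κ : Cardinal.{u}} {B : Type u} [NormedAddCommGroup B]
    [NormedSpace 𝕜 B] [CompleteSpace B]

/-- In a monster, satisfaction of positive bounded formulas depends only on the seminorm induced by
a tuple, and is preserved under limits of these seminorms along an ultrafilter. -/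
theorem IsMonster.realize_of_tendsto (hB : IsMonster 𝕜 κ B) (hκ : 𝔠 < κ) {ι : Type*}
    (U : Ultrafilter ι) {n : ℕ} (φ : PBFormula 𝕜 n) (v : ι → Fin n → B) (v' : Fin n → B)
    (hv : ∀ t, Tendsto (fun i => ‖Fintype.linearCombination 𝕜 (v i) t‖) U
      (𝓝 ‖Fintype.linearCombination 𝕜 v' t‖))
    (hφ : ∀ᶠ i in (U : Filter ι), φ.Realize (v i)) : φ.Realize v' := by
  induction φ with
  | normLE t r => exact le_of_tendsto (hv t) hφ
  | normGE t r => exact ge_of_tendsto (hv t) hφ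
  | conj φ ψ ih₁ ih₂ =>
    exact ⟨ih₁ v v' hv (hφ.mono fun _ h => h.1), ih₂ v v' hv (hφ.mono fun _ h => h.2)⟩
  | disj φ ψ ih₁ ih₂ =>
    exact (Ultrafilter.eventually_or.1 hφ).imp (ih₁ v v' hv) (ih₂ v v' hv)
  | @bex n r φ ih =>
    have hx : ∃ x : ι → B, ∀ᶠ i in (U : Filter ι), ‖x i‖ ≤ r ∧
        φ.Realize (Fin.snoc (α := fun _ => B) (v i) (x i)) := by
      classical
      refine ⟨fun i => if h : ∃ x : B, ‖x‖ ≤ r ∧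
        φ.Realize (Fin.snoc (α := fun _ => B) (v i) x) then h.choose else 0, hφ.mono fun i hi => ?_⟩
      have hi' : ∃ x : B, ‖x‖ ≤ r ∧ φ.Realize (Fin.snoc (α := fun _ => B) (v i) x) := hi
      simp only [dif_pos hi']
      exact hi'.choose_spec
    obtain ⟨x, hx⟩ := hx
    -- the witnesses over `v i` converge to a one-point extension of `v'`, realized in the monster
    let N : ι → Seminorm 𝕜 ((Fin n → 𝕜) × 𝕜) := fun i => (normSeminorm 𝕜 B).comp
      ((Fintype.linearCombination 𝕜 (v i)).coprod (LinearMap.toSpanSingleton 𝕜 B (x i)))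
    have hN : ∀ i t s, N i (t, s) = ‖Fintype.linearCombination 𝕜 (v i) t + s • x i‖ :=
      fun i t s => by simp [N, LinearMap.coprod_apply]
    have hlim : ∀ w, ∃ c, Tendsto (fun i => N i w) U (𝓝 c) := by
      rintro ⟨t, s⟩
      have hb : ∀ᶠ i in (U : Filter ι),
          N i (t, s) ∈ Set.Icc 0 (‖Fintype.linearCombination 𝕜 v' t‖ + 1 + ‖s‖ * r) := by
        filter_upwards [(hv t).eventually_le_const (lt_add_one _), hx] with i hi hxi
        refine ⟨apply_nonneg _ _, ?_⟩
        rw [hN]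
        refine (norm_add_le _ _).trans (add_le_add hi ?_)
        rw [norm_smul]
        gcongr
        exact hxi.1
      obtain ⟨c, -, hc⟩ := isCompact_Icc.ultrafilter_le_nhds (U.map fun i => N i (t, s))
        (le_principal_iff.2 hb)
      exact ⟨c, hc⟩
    obtain ⟨N', hN'⟩ := Seminorm.exists_tendsto N hlim
    obtain ⟨y, hy⟩ := hB.exists_extension hκ v' N' fun t =>
      tendsto_nhds_unique ((hN' (t, 0)).congr fun i => by simp [hN]) (hv t)
    refine ⟨y, ?_, ih (fun i => Fin.snoc (α := fun _ => B) (v i) (x i)) _ (fun t => ?_)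
      (hx.mono fun _ h => h.2)⟩
    · have h1 : ‖y‖ = N' (0, 1) := by simpa using hy 0 1
      rw [h1]
      exact le_of_tendsto (hN' (0, 1)) (hx.mono fun i h => by simpa [hN] using h.1)
    · simp only [Fintype.linearCombination_snoc, hy, ← hN]
      exact hN' _
  | @ball n r φ ih =>
    intro x hx
    let N : Seminorm 𝕜 ((Fin n → 𝕜) × 𝕜) := (normSeminorm 𝕜 B).comp
      ((Fintype.linearCombination 𝕜 v').coprod (LinearMap.toSpanSingleton 𝕜 B x))
    have hN : ∀ t s, N (t, s) = ‖Fintype.linearCombination 𝕜 v' t + s • x‖ :=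
      fun t s => by simp [N, LinearMap.coprod_apply]
    let P : (Fin n → B) → Seminorm 𝕜 (Fin n → 𝕜) := fun v =>
      (normSeminorm 𝕜 B).comp (Fintype.linearCombination 𝕜 v)
    obtain ⟨ε, hε, hε0⟩ := Seminorm.exists_tendsto_zero_of_tendsto
      (N := fun i => P (v i)) (N' := P v') hv
    -- a copy of `x` over each `v i`, at a vanishing distance from its position over `v'`
    have hy : ∀ i, ∃ y : B, ‖y‖ ≤ r ∧ ∀ t s,
        |‖Fintype.linearCombination 𝕜 (v i) t + s • y‖ - N (t, s)| ≤ ε i * ‖t‖ := by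
      intro i
      obtain ⟨N', h0, h1, h2⟩ := N.exists_extension_near (P (v i)) (ε i) fun w => by
        simpa [hN, P] using hε i w
      obtain ⟨y, hy⟩ := hB.exists_extension hκ (v i) N' h0
      refine ⟨y, ?_, fun t s => by rw [hy]; exact h2 t s⟩
      have h3 : ‖y‖ = N' (0, 1) := by simpa using hy 0 1
      have h4 : N (0, 1) = ‖x‖ := by simp [hN]
      rw [h3]
      exact (h1 1).trans (h4.trans_le hx)
    choose y hyr hy using hy
    refine ih (fun i => Fin.snoc (α := fun _ => B) (v i) (y i)) _ (fun t => ?_)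
      (hφ.mono fun i hi => hi (y i) (hyr i))
    simp only [Fintype.linearCombination_snoc, ← hN]
    refine tendsto_iff_dist_tendsto_zero.2 (squeeze_zero (fun _ => dist_nonneg) (fun i => hy i _ _) ?_)
    simpa using (NNReal.tendsto_coe.2 hε0).mul_const ‖Fin.init t‖

end Closed

theorem Fintype.linearCombination_append {𝕜 B : Type*} [RCLike 𝕜] [AddCommGroup B] [Module 𝕜 B]
    {n : ℕ} (x y : Fin n → B) (t : Fin (n + n) → 𝕜) :
    Fintype.linearCombination 𝕜 (Fin.append x y) t =
      Fintype.linearCombination 𝕜 x (fun i => t (Fin.castAdd n i)) +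
        Fintype.linearCombination 𝕜 y (fun i => t (Fin.natAdd n i)) := by
  simp only [Fintype.linearCombination_apply, Fin.sum_univ_add, Fin.append_left, Fin.append_right]

/-- Every linear map on `Fin n → 𝕜` is `t ↦ ∑ i, t i • v i` for some tuple `v`. -/
theorem exists_linearCombination_eq {𝕜 B : Type*} [RCLike 𝕜] [AddCommGroup B] [Module 𝕜 B]
    {n : ℕ} (A : (Fin n → 𝕜) →ₗ[𝕜] B) : ∃ v : Fin n → B, Fintype.linearCombination 𝕜 v = A :=
  ⟨fun i => A (Pi.single i 1), LinearMap.pi_ext' fun i => by ext; simp⟩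

/-- Increasing pairs of an indiscernible family induce one and the same seminorm. -/
theorem IsIndiscernible.norm_eq {𝕜 : Type} [RCLike 𝕜] {B : Type u} [NormedAddCommGroup B]
    [NormedSpace 𝕜 B] {n : ℕ} {I : Type u} [LinearOrder I] {a : I → Fin n → B}
    (ha : IsIndiscernible 𝕜 a) {i j k l : I} (hij : i < j) (hkl : k < l) (s t : Fin n → 𝕜) :
    ‖Fintype.linearCombination 𝕜 (a i) s + Fintype.linearCombination 𝕜 (a j) t‖ =
      ‖Fintype.linearCombination 𝕜 (a k) s + Fintype.linearCombination 𝕜 (a l) t‖ := by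
  let c : Fin (2 * n) → 𝕜 := fun p => ![s, t] (finProdFinEquiv.symm p).1 (finProdFinEquiv.symm p).2
  have hc : ∀ i j, ∑ p, c p • concatTuples (fun m => a (![i, j] m)) p =
      Fintype.linearCombination 𝕜 (a i) s + Fintype.linearCombination 𝕜 (a j) t := by
    intro i j
    rw [← Equiv.sum_comp finProdFinEquiv, Fintype.sum_prod_type, Fin.sum_univ_two]
    simp only [c, concatTuples, Equiv.symm_apply_apply, Fintype.linearCombination_apply]
    rfl
  have hmono : ∀ {i j : I}, i < j → StrictMono ![i, j] := fun h => by
    simpa [Fin.strictMono_iff_lt_succ] using h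
  have key : ∀ {i j k l : I}, i < j → k < l →
      ‖Fintype.linearCombination 𝕜 (a i) s + Fintype.linearCombination 𝕜 (a j) t‖ ≤
        ‖Fintype.linearCombination 𝕜 (a k) s + Fintype.linearCombination 𝕜 (a l) t‖ := by
    intro i j k l hij hkl
    have h := ha 2 ![k, l] ![i, j] (hmono hkl) (hmono hij)
    rw [← hc, ← hc]
    have hmem : PBFormula.normLE c ‖∑ p, c p • concatTuples (fun m => a (![k, l] m)) p‖ ∈
        tp 𝕜 (concatTuples fun m => a (![k, l] m)) := le_refl ‖_‖
    rw [h] at hmem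
    exact hmem
  exact le_antisymm (key hij hkl) (key hkl hij)

/-! ### Pairs of tuples related by a positive bounded type -/

section Chain

variable {𝕜 : Type} [RCLike 𝕜] {κ : Cardinal.{u}} {B : Type u} [NormedAddCommGroup B]
    [NormedSpace 𝕜 B] {n : ℕ}

/-- The seminorm `(s, t) ↦ ‖s · x + t · y‖` induced by a pair of tuples. -/
noncomputable def pairSeminorm (𝕜 : Type) [RCLike 𝕜] [NormedSpace 𝕜 B] (x y : Fin n → B) :
    Seminorm 𝕜 ((Fin n → 𝕜) × (Fin n → 𝕜)) :=
  (normSeminorm 𝕜 B).comp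
    ((Fintype.linearCombination 𝕜 x).coprod (Fintype.linearCombination 𝕜 y))

theorem pairSeminorm_apply (x y : Fin n → B) (s t : Fin n → 𝕜) :
    pairSeminorm 𝕜 x y (s, t) =
      ‖Fintype.linearCombination 𝕜 x s + Fintype.linearCombination 𝕜 y t‖ := rfl

theorem pairSeminorm_self_neg (x : Fin n → B) (s : Fin n → 𝕜) :
    pairSeminorm 𝕜 x x (s, -s) = 0 := by
  simp [pairSeminorm_apply]

theorem eq_of_pairSeminorm_neg_eq_zero {x y : Fin n → B}
    (h : ∀ s : Fin n → 𝕜, pairSeminorm 𝕜 x y (s, -s) = 0) : x = y := by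
  funext i
  have := h (Pi.single i 1)
  rw [pairSeminorm_apply, map_neg, ← sub_eq_add_neg, norm_eq_zero, sub_eq_zero] at this
  simpa using this

/-- Each inequality is the triangle inequality for `x`, `y`, `z`, after some of the pairs have been
replaced by isometric ones. -/
theorem isChainSeminorm_pairSeminorm {x y z : Fin n → B}
    (hxz : pairSeminorm 𝕜 x z = pairSeminorm 𝕜 x y)
    (hyz : pairSeminorm 𝕜 y z = pairSeminorm 𝕜 x y) : IsChainSeminorm (pairSeminorm 𝕜 x y) where
  le_trans s t w := by
    nth_rw 3 [← hyz]
    nth_rw 1 [← hxz]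
    simp only [pairSeminorm_apply, map_neg]
    refine (norm_add_le _ _).trans' (le_of_eq ?_)
    congr 1
    abel
  diag_le w t := by
    rw [two_mul]
    nth_rw 3 [← hyz]
    nth_rw 2 [← hxz]
    simp only [pairSeminorm_apply, map_neg]
    refine (norm_sub_le _ _).trans' (le_of_eq ?_)
    congr 1
    abel
  swap_left u s := by
    nth_rw 3 [← hxz]
    nth_rw 2 [← hyz]
    simp only [pairSeminorm_apply, map_neg]
    refine (norm_add_le _ _).trans' (le_of_eq ?_)
    congr 1
    abel
  swap_right t u := by
    nth_rw 3 [← hxz]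
    nth_rw 1 [← hyz]
    simp only [pairSeminorm_apply, map_neg]
    refine (norm_sub_le _ _).trans' (le_of_eq ?_)
    congr 1
    abel
  left_eq_right s := by
    nth_rw 1 [← hyz]
    simp [pairSeminorm_apply]

variable [CompleteSpace B]

theorem IsMonster.exists_pairSeminorm_eq (hB : IsMonster 𝕜 κ B) (hκ : 𝔠 < κ)
    (N : Seminorm 𝕜 ((Fin n → 𝕜) × (Fin n → 𝕜))) :
    ∃ x y : Fin n → B, pairSeminorm 𝕜 x y = N := by
  obtain ⟨L, hL⟩ := hB.exists_linearMap_norm_eq hκ N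
  obtain ⟨x, hx⟩ := exists_linearCombination_eq (L ∘ₗ LinearMap.inl 𝕜 _ _)
  obtain ⟨y, hy⟩ := exists_linearCombination_eq (L ∘ₗ LinearMap.inr 𝕜 _ _)
  refine ⟨x, y, Seminorm.ext fun ⟨s, t⟩ => ?_⟩
  rw [pairSeminorm_apply, hx, hy, ← hL]
  simp [← map_add]

/-- The relation defined by a positive bounded type is closed under limits of seminorms. -/
theorem IsMonster.rel_of_tendsto (hB : IsMonster 𝕜 κ B) (hκ : 𝔠 < κ) (q : PBType 𝕜 (n + n))
    {x y : ℕ → Fin n → B} {x' y' : Fin n → B}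
    (h : ∀ w, Tendsto (fun m => pairSeminorm 𝕜 (x m) (y m) w) atTop (𝓝 (pairSeminorm 𝕜 x' y' w)))
    (hq : ∀ m, q.rel B (x m) (y m)) : q.rel B x' y' := by
  intro φ hφ
  refine hB.realize_of_tendsto hκ (hyperfilter ℕ) φ (fun m => Fin.append (x m) (y m)) _
    (fun t => ?_) (Eventually.of_forall fun m => hq m φ hφ)
  simp only [Fintype.linearCombination_append]
  exact (h (_, _)).mono_left Nat.hyperfilter_le_atTop

/-- The relation defined by a positive bounded type depends only on the seminorm of a pair. -/
theorem IsMonster.rel_of_pairSeminorm_eq (hB : IsMonster 𝕜 κ B) (hκ : 𝔠 < κ)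
    (q : PBType 𝕜 (n + n)) {x y x' y' : Fin n → B}
    (h : pairSeminorm 𝕜 x y = pairSeminorm 𝕜 x' y') (hq : q.rel B x y) : q.rel B x' y' :=
  hB.rel_of_tendsto hκ q (x := fun _ => x) (y := fun _ => y)
    (fun w => by rw [h]; exact tendsto_const_nhds) fun _ => hq

/-- The free amalgam of two related pairs shows that their composition is the seminorm of a related
pair, if the relation is transitive. -/
theorem IsMonster.exists_rel_comp (hB : IsMonster 𝕜 κ B) (hκ : 𝔠 < κ) (q : PBType 𝕜 (n + n))
    (htrans : ∀ x y z, q.rel B x y → q.rel B y z → q.rel B x z) {x y x' y' : Fin n → B}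
    (hxy : q.rel B x y) (hxy' : q.rel B x' y')
    (h : ∀ u, pairSeminorm 𝕜 x y (0, u) = pairSeminorm 𝕜 x' y' (u, 0)) :
    ∃ a b : Fin n → B, q.rel B a b ∧
      pairSeminorm 𝕜 a b = seminormComp (pairSeminorm 𝕜 x y) (pairSeminorm 𝕜 x' y') := by
  obtain ⟨L, hL⟩ := hB.exists_linearMap_norm_eq hκ
    (freeAmalgam (pairSeminorm 𝕜 x y) (pairSeminorm 𝕜 x' y'))
  obtain ⟨a, ha⟩ := exists_linearCombination_eq (L ∘ₗ LinearMap.inl 𝕜 _ _)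
  obtain ⟨b, hb⟩ := exists_linearCombination_eq (L ∘ₗ LinearMap.inr 𝕜 _ _ ∘ₗ LinearMap.inl 𝕜 _ _)
  obtain ⟨c, hc⟩ := exists_linearCombination_eq (L ∘ₗ LinearMap.inr 𝕜 _ _ ∘ₗ LinearMap.inr 𝕜 _ _)
  have hab : pairSeminorm 𝕜 a b = pairSeminorm 𝕜 x y := Seminorm.ext fun ⟨s, t⟩ => by
    rw [pairSeminorm_apply, ha, hb, ← freeAmalgam_left h, ← hL]
    simp [← map_add]
  have hbc : pairSeminorm 𝕜 b c = pairSeminorm 𝕜 x' y' := Seminorm.ext fun ⟨s, t⟩ => by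
    rw [pairSeminorm_apply, hb, hc, ← freeAmalgam_right h, ← hL]
    simp [← map_add]
  refine ⟨a, c, htrans a b c (hB.rel_of_pairSeminorm_eq hκ q hab.symm hxy)
    (hB.rel_of_pairSeminorm_eq hκ q hbc.symm hxy'), Seminorm.ext fun ⟨s, t⟩ => ?_⟩
  rw [pairSeminorm_apply, ha, hc, seminormComp_apply, ← hL]
  simp [← map_add]

/-- If a pair whose seminorm is a chain seminorm is related by a transitive relation, then every
iterated composition of that seminorm is the seminorm of a related pair. -/
theorem IsMonster.exists_rel_pow (hB : IsMonster 𝕜 κ B) (hκ : 𝔠 < κ) (q : PBType 𝕜 (n + n))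
    (htrans : ∀ x y z, q.rel B x y → q.rel B y z → q.rel B x z) {x y : Fin n → B}
    (hxy : q.rel B x y) (hp : IsChainSeminorm (pairSeminorm 𝕜 x y)) (m : ℕ) :
    ∃ a b : Fin n → B, q.rel B a b ∧
      pairSeminorm 𝕜 a b = seminormPow (pairSeminorm 𝕜 x y) m := by
  induction m with
  | zero => exact ⟨x, y, hxy, rfl⟩
  | succ m ih =>
    obtain ⟨a, b, hab, h⟩ := ih
    rw [seminormPow, ← h]
    exact hB.exists_rel_comp hκ q htrans hab hxy fun u => by rw [h, hp.pow_zero_left]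

end Chain

/-! ### Failure of the strict order property -/

theorem IsMonster.not_exemplifiesSOP {𝕜 : Type} [RCLike 𝕜] {κ : Cardinal.{u}} {B : Type u}
    [NormedAddCommGroup B] [NormedSpace 𝕜 B] [CompleteSpace B] (hB : IsMonster 𝕜 κ B)
    (hκ : 𝔠 < κ) {n : ℕ} (q : PBType 𝕜 (n + n)) : ¬ ExemplifiesSOP 𝕜 (q.rel B) := by
  rintro ⟨htrans, hanti, I, _, _, a, ha, hchain⟩
  obtain ⟨T, hT⟩ := Infinite.exists_subset_card_eq I 3
  let e := T.orderEmbOfFin hT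
  have h01 : e 0 < e 1 := e.strictMono (by decide)
  have h12 : e 1 < e 2 := e.strictMono (by decide)
  have hpair : ∀ {i j k l : I}, i < j → k < l →
      pairSeminorm 𝕜 (a i) (a j) = pairSeminorm 𝕜 (a k) (a l) := fun hij hkl =>
    Seminorm.ext fun ⟨s, t⟩ => ha.norm_eq hij hkl s t
  have hp : IsChainSeminorm (pairSeminorm 𝕜 (a (e 0)) (a (e 1))) :=
    isChainSeminorm_pairSeminorm (hpair (h01.trans h12) h01) (hpair h12 h01)
  obtain ⟨hR, hne⟩ := hchain _ _ h01
  choose x y hxy hx using hB.exists_rel_pow hκ q htrans hR hp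
  obtain ⟨N, hN, hpN, hsymm⟩ := hp.exists_symm_limit
  obtain ⟨x', y', rfl⟩ := hB.exists_pairSeminorm_eq hκ N
  have h : q.rel B x' y' := hB.rel_of_tendsto hκ q (fun w => by simpa only [hx] using hN w) hxy
  have h' : q.rel B y' x' := hB.rel_of_pairSeminorm_eq hκ q (Seminorm.ext fun ⟨s, t⟩ => by
    rw [hsymm, pairSeminorm_apply, pairSeminorm_apply, add_comm]) h
  obtain rfl := hanti _ _ h h'
  exact hne (eq_of_pairSeminorm_neg_eq_zero fun s =>
    le_antisymm ((hpN _).trans_eq (pairSeminorm_self_neg x' s)) (apply_nonneg _ _))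

theorem mainTheorem2 {𝕜 : Type} [RCLike 𝕜] (κ : Cardinal.{u}) (hκ : 𝔠 < κ)
    {B : Type u} [NormedAddCommGroup B] [NormedSpace 𝕜 B] [CompleteSpace B]
    (hB : IsMonster 𝕜 κ B) :
    (∀ (n : ℕ) (q : PBType 𝕜 (n + n)), ¬ ExemplifiesSOP 𝕜 (q.rel B)) ∧
    (∀ (n : ℕ) (φ : PBFormula 𝕜 (n + n)), ¬ ExemplifiesSOP 𝕜 (φ.rel B)) := by
  refine ⟨fun n q => hB.not_exemplifiesSOP hκ q, fun n φ => ?_⟩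
  have h : φ.rel B = PBType.rel {φ} B := by
    funext x y
    simp [PBFormula.rel, PBType.rel]
  rw [h]
  exact hB.not_exemplifiesSOP hκ _
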